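/- For real $\beta>1$ and $\alpha\in[0,1]$ let $T_\alpha(x)=\beta x+\alpha \pmod 1$ on the circle $\mathbb{R}/\mathbb{Z}$, and write $T_\alpha^m(0^+)=\lim_{x\downarrow 0}T_\alpha^m(x)$ and $T_\alpha^m(0^-)=\lim_{x\uparrow 1}T_\alpha^m(x)$. We say that $T_\alpha$ has matching if $T_\alpha^m(0^+)=T_\alpha^m(0^-)$ in $\mathbb{R}/\mathbb{Z}$ for some $m\ge 1$, and put $A_\beta=\{\alpha\in[0,1] : T_\alpha \text{ does not have matching}\}$. A Pisot number is a real algebraic integer $\beta>1$ all of whose Galois conjugates other than $\beta$ itself have modulus strictly less than $1$. Let $\beta>1$ be an algebraic number of degree $2$ over $\mathbb{Q}$. Then: (i) $T_\alpha$ has matching for some $\alpha\in[0,1]$ if and only if $\beta$ is Pisot. (In particular, if $\beta$ is not Pisot then there is no matching for any $\alpha$.) (ii) $\beta$ is Pisot if and only if there are integers $k,d\ge 1$ such that either $\beta^2-k\beta+d=0$ with $k>d+1$, or $\beta^2-k\beta-d=0$ with $k>d-1$. (iii) For all integers $k,d\ge1$ as in (ii), in either case, $\dim_H(A_\beta)=\dfrac{\log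 d}{\log \beta}$. -/

import Mathlib

open Filter Topology

/-- The generalised `β`-transformation `x ↦ β x + α (mod 1)`, with values represented in `[0, 1)`. -/
noncomputable def genBeta (β α x : ℝ) : ℝ := Int.fract (β * x + α)

/-- `T_α` has matching: for some `m ≥ 1` the one-sided iterates
`T_α^m(0⁺) = lim_{x ↓ 0} T_α^m(x)` and `T_α^m(0⁻) = lim_{x ↑ 1} T_α^m(x)` are the same point of the
circle `ℝ / ℤ` on which `T_α` acts. -/
def HasMatching (β α : ℝ) : Prop :=
  ∃ m : ℕ, 1 ≤ m ∧ ∃ a b : ℝ,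
    Tendsto (genBeta β α)^[m] (𝓝[>] 0) (𝓝 a) ∧
    Tendsto (genBeta β α)^[m] (𝓝[<] 1) (𝓝 b) ∧
    (a : AddCircle (1 : ℝ)) = (b : AddCircle (1 : ℝ))

/-- The non-matching set `A_β`. -/
def nonMatchingSet (β : ℝ) : Set ℝ := {α | α ∈ Set.Icc (0 : ℝ) 1 ∧ ¬ HasMatching β α}

/-- Pisot numbers: real algebraic integers `β > 1` all of whose Galois conjugates other than `β`
itself lie in the open unit disk. -/
def IsPisot (β : ℝ) : Prop :=
  1 < β ∧ IsIntegral ℤ β ∧ ∀ z ∈ (minpoly ℚ β).aroots ℂ, z ≠ (β : ℂ) → ‖z‖ < 1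

/-- `β² - kβ + d = 0` with `k > d + 1`, or `β² - kβ - d = 0` with `k > d - 1`, where `k, d ≥ 1`. -/
def IsPisotEquation (β : ℝ) (k d : ℕ) : Prop :=
  1 ≤ k ∧ 1 ≤ d ∧
    ((β ^ 2 - k * β + d = 0 ∧ (k : ℝ) > d + 1) ∨ (β ^ 2 - k * β - d = 0 ∧ (k : ℝ) > d - 1))

/-!
Write `β'` for the Galois conjugate of a quadratic integer `β` and `b = |β'|`, so that the norm of
`β` is `±d` with `d = b β`. The gap `δ_m = T^m(0⁻) - T^m(0⁺)` lies in `[-1, 1]`, starts at `1` and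
satisfies `δ_{m+1} = β δ_m + integer`; matching means that some `δ_m`, `m ≥ 1`, is an integer.
So matching makes `β` a root of a monic integer polynomial. For an algebraic integer `β`, writing
`δ_m = x_m + y_m β` gives `y_{m+1} = β' y_m + δ_m`, and if `|β'| > 1` then `y_m` can never return
to `0` once it is nonzero. Hence matching forces `β` to be Pisot. The description of Pisot numbers
by equations is a matter of the signs of the minimal polynomial at `±1`.

Let now `0 < b < 1`. As long as no matching has occurred, `δ_m` modulo `1` is forced: it is
`-β'` at every step if `β' > 0`, and alternates between `-β'` and `β'` if `β' < 0`. Matching at the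
next step is decided by whether `T^m(0⁺)` lies outside an arc of length `b`, which `T` stretches to
length exactly `d`. Collapsing the complement of the arc to a point (`collapse`) turns the critical
orbit into the orbit `Y_0 = γ`, `Y_{m+1} = d π(Y_m) + γ` of a monotone circle map of degree `d`,
where `γ` is `α` or `α + b` and `π` is `collapse b`, and no matching means that no `Y_m` falls into
the collapsed arc (`coding_of_add_eq_int`, `coding_of_sub_eq_int`; boundary points of the arc only
cost countably many values in what follows). Every `Y_m` is monotone in `γ`.

* Upper bound. For non-matching parameters with equal floors `⌊Y_i⌋`, `i ≤ m`, the distance is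
  expanded by `β` at each step, so they are within `β⁻ᵐ` of each other. By monotonicity the floors
  are determined by their sum, which takes at most `2 (m + 1)² dᵐ` values. Covering by the
  corresponding pieces gives dimension at most `log d / log β`.
* Lower bound. `h(γ) = lim Y_m(γ) / dᵐ` exists if `d ≥ 2`, is Hölder of exponent `log d / log β`,
  and its values fill an interval. Where an orbit hits the collapsed arc it restarts, up to an
  integer, at `γ`, so that `h(γ)` solves a linear equation over `ℚ`. Hence the image of the
  non-matching set is an interval up to rational points and has dimension `1`.

Since `d < β`, the dimension is less than `1`, so matching does occur for a Pisot number.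
-/

/-! ### The collapse map and the collapsed orbit -/

/-- The monotone map `ℝ → ℝ`, commuting with integer translations, that stretches each `[n, n + b]`
onto `[n, n + 1]` and sends `[n + b, n + 1]` to `n + 1`. -/
noncomputable def collapse (b x : ℝ) : ℝ := ⌊x⌋ + min (Int.fract x / b) 1

/-- The orbit of `γ` under `x ↦ d * collapse b x + γ`, a lift of a circle map of degree `d`. The
parameter is both the starting point and the translation, as for the orbit of `0⁺` under `T_α`,
which passes through `α`. -/
noncomputable def collapsedOrbit (b : ℝ) (d : ℕ) (γ : ℝ) : ℕ → ℝ
  | 0 => γ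
  | m + 1 => d * collapse b (collapsedOrbit b d γ m) + γ

section Collapse

variable {b : ℝ}

theorem collapse_add_int (x : ℝ) (n : ℤ) : collapse b (x + n) = collapse b x + n := by
  unfold collapse
  rw [Int.floor_add_intCast, Int.fract_add_intCast]
  push_cast
  ring

theorem collapse_le_floor_add_one (x : ℝ) : collapse b x ≤ ⌊x⌋ + 1 := by
  unfold collapse
  gcongr
  exact min_le_right _ _

theorem floor_le_collapse (hb : 0 < b) (x : ℝ) : (⌊x⌋ : ℝ) ≤ collapse b x := by
  unfold collapse
  have : 0 ≤ min (Int.fract x / b) 1 :=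
    le_min (div_nonneg (Int.fract_nonneg x) hb.le) zero_le_one
  linarith

theorem collapse_mono (hb : 0 < b) : Monotone (collapse b) := by
  intro x y hxy
  rcases (Int.floor_mono hxy).eq_or_lt with h | h
  · unfold collapse
    rw [h]
    have : Int.fract x ≤ Int.fract y := by
      unfold Int.fract
      rw [h]
      linarith
    gcongr
  · have h1 : (⌊x⌋ : ℝ) + 1 ≤ ⌊y⌋ := by exact_mod_cast h
    linarith [collapse_le_floor_add_one (b := b) x, floor_le_collapse hb y]

theorem collapse_sub_le (hb : 0 < b) (hb1 : b < 1) {x y : ℝ} (hxy : x ≤ y) :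
    collapse b y - collapse b x ≤ (y - x) / b := by
  have hx := Int.floor_add_fract x
  have hy := Int.floor_add_fract y
  rcases (Int.floor_mono hxy).eq_or_lt with h | h
  · have hf : Int.fract y - Int.fract x = y - x := by
      unfold Int.fract
      rw [h]
      ring
    unfold collapse
    rw [h, ← hf, sub_div]
    have h0 : 0 ≤ Int.fract y / b - Int.fract x / b := by
      rw [← sub_div, hf]
      exact div_nonneg (by linarith) hb.le
    rcases le_total (Int.fract x / b) 1 with h1 | h1
    · rw [min_eq_left h1]
      linarith [min_le_left (Int.fract y / b) 1]
    · rw [min_eq_right h1]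
      linarith [min_le_right (Int.fract y / b) 1]
  · have h1 : (⌊x⌋ : ℝ) + 1 ≤ ⌊y⌋ := by exact_mod_cast h
    have h2 : collapse b y ≤ ⌊y⌋ + Int.fract y / b := by
      unfold collapse
      gcongr
      exact min_le_left _ _
    have h3 : (⌊x⌋ : ℝ) + (1 - (1 - Int.fract x) / b) ≤ collapse b x := by
      unfold collapse
      gcongr
      refine le_min ?_ ?_
      · rw [← sub_nonneg]
        have : Int.fract x / b - (1 - (1 - Int.fract x) / b) = (1 - b) / b := by
          field_simp
          ring
        rw [this]
        exact div_nonneg (by linarith) hb.le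
      · have := div_nonneg (sub_nonneg.2 (Int.fract_lt_one x).le) hb.le
        linarith
    have h4 : ((⌊y⌋ : ℝ) - ⌊x⌋ - 1) ≤ (⌊y⌋ - ⌊x⌋ - 1) / b := by
      rw [le_div_iff₀ hb]
      nlinarith
    have h5 : (y - x) / b = Int.fract y / b + (⌊y⌋ - ⌊x⌋ - 1) / b + (1 - Int.fract x) / b := by
      rw [← add_div, ← add_div]
      congr 1
      linarith
    linarith

theorem abs_collapse_sub_le (hb : 0 < b) (hb1 : b < 1) (x y : ℝ) :
    |collapse b x - collapse b y| ≤ |x - y| / b := by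
  wlog h : y ≤ x generalizing x y
  · rw [abs_sub_comm, abs_sub_comm x]
    exact this y x (le_of_not_ge h)
  rw [abs_of_nonneg (sub_nonneg.2 (collapse_mono hb h)), abs_of_nonneg (sub_nonneg.2 h)]
  exact collapse_sub_le hb hb1 h

theorem collapse_of_fract_le (hb : 0 < b) {x : ℝ} (hx : Int.fract x ≤ b) :
    collapse b x = ⌊x⌋ + Int.fract x / b := by
  unfold collapse
  rw [min_eq_left ((div_le_one hb).2 hx)]

/-- Both endpoints of the arc `[0, b]` are already sent to integers. -/
theorem exists_int_eq_collapse (hb : 0 < b) {x : ℝ} (hx : ¬(0 < Int.fract x ∧ Int.fract x < b)) :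
    ∃ n : ℤ, collapse b x = n := by
  rcases (Int.fract_nonneg x).eq_or_lt with h | h
  · exact ⟨⌊x⌋, by simp [collapse, ← h]⟩
  · have h1 : b ≤ Int.fract x := by
      by_contra h2
      exact hx ⟨h, not_le.1 h2⟩
    refine ⟨⌊x⌋ + 1, ?_⟩
    unfold collapse
    rw [min_eq_right ((one_le_div hb).2 h1)]
    push_cast
    rfl

theorem abs_collapse_sub_self_le (hb : 0 < b) (x : ℝ) : |collapse b x - x| ≤ 1 := by
  rw [abs_le]
  have h1 := collapse_le_floor_add_one (b := b) x
  have h2 := floor_le_collapse hb x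
  have h3 := Int.floor_le x
  have h4 := Int.lt_floor_add_one x
  constructor <;> linarith

end Collapse

section Orbit

variable {b : ℝ} {d : ℕ}

theorem collapsedOrbit_succ (γ : ℝ) (m : ℕ) :
    collapsedOrbit b d γ (m + 1) = d * collapse b (collapsedOrbit b d γ m) + γ := rfl

theorem collapsedOrbit_mono (hb : 0 < b) (m : ℕ) :
    Monotone fun γ => collapsedOrbit b d γ m := by
  intro x y hxy
  induction m with
  | zero => exact hxy
  | succ m ih =>
    simp only [collapsedOrbit_succ]
    have := collapse_mono hb ih
    gcongr

/-- The number `1 + d + ⋯ + dᵐ`, by which the `m`-th point of the collapsed orbit grows when the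
parameter grows by `1`. -/
def repunit (d : ℕ) : ℕ → ℕ
  | 0 => 1
  | m + 1 => d * repunit d m + 1

theorem repunit_le (hd : 1 ≤ d) (m : ℕ) : repunit d m ≤ (m + 1) * d ^ m := by
  induction m with
  | zero => simp [repunit]
  | succ m ih =>
    have h1 : 1 ≤ d ^ (m + 1) := Nat.one_le_pow _ _ hd
    calc repunit d (m + 1) = d * repunit d m + 1 := rfl
      _ ≤ d * ((m + 1) * d ^ m) + d ^ (m + 1) := by gcongr
      _ = (m + 1 + 1) * d ^ (m + 1) := by ring

theorem pow_le_repunit (m : ℕ) : d ^ m ≤ repunit d m := by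
  induction m with
  | zero => simp [repunit]
  | succ m ih =>
    calc d ^ (m + 1) = d * d ^ m := by ring
      _ ≤ d * repunit d m := by gcongr
      _ ≤ repunit d (m + 1) := Nat.le_succ _

theorem collapsedOrbit_add_one (γ : ℝ) (m : ℕ) :
    collapsedOrbit b d (γ + 1) m = collapsedOrbit b d γ m + repunit d m := by
  induction m with
  | zero => simp [collapsedOrbit, repunit]
  | succ m ih =>
    have := collapse_add_int (b := b) (collapsedOrbit b d γ m) (repunit d m)
    rw [Int.cast_natCast] at this
    rw [collapsedOrbit_succ, ih, this, collapsedOrbit_succ, repunit]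
    push_cast
    ring

/-- An orbit that enters the collapsed arc restarts at `γ`, up to an integer translation. -/
theorem collapsedOrbit_of_collapse_eq_int {γ : ℝ} {m : ℕ} {n : ℤ}
    (h : collapse b (collapsedOrbit b d γ m) = n) (j : ℕ) :
    collapsedOrbit b d γ (m + 1 + j) = collapsedOrbit b d γ j + d ^ (j + 1) * n := by
  induction j with
  | zero =>
    rw [add_zero, collapsedOrbit_succ, h, collapsedOrbit]
    ring
  | succ j ih =>
    have := collapse_add_int (b := b) (collapsedOrbit b d γ j) (d ^ (j + 1) * n)
    push_cast at this
    rw [← add_assoc, collapsedOrbit_succ, ih, this, collapsedOrbit_succ]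
    ring

/-- Parameters whose orbits avoid the collapsed arc and have the same integer parts are separated
at rate `d / b`. -/
theorem le_collapsedOrbit_sub (hb : 0 < b) (m : ℕ) {x y : ℝ} (hxy : x ≤ y)
    (hx : ∀ i < m, Int.fract (collapsedOrbit b d x i) ≤ b)
    (hy : ∀ i < m, Int.fract (collapsedOrbit b d y i) ≤ b)
    (hf : ∀ i < m, ⌊collapsedOrbit b d x i⌋ = ⌊collapsedOrbit b d y i⌋) :
    (d / b) ^ m * (y - x) ≤ collapsedOrbit b d y m - collapsedOrbit b d x m := by
  induction m with
  | zero => simp [collapsedOrbit]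
  | succ m ih =>
    have h := ih (fun i hi => hx i (by lia)) (fun i hi => hy i (by lia)) fun i hi => hf i (by lia)
    have hm := Nat.lt_succ_self m
    rw [collapsedOrbit_succ, collapsedOrbit_succ, collapse_of_fract_le hb (hx m hm),
      collapse_of_fract_le hb (hy m hm), hf m hm]
    have h2 : Int.fract (collapsedOrbit b d y m) - Int.fract (collapsedOrbit b d x m) =
        collapsedOrbit b d y m - collapsedOrbit b d x m := by
      unfold Int.fract
      rw [hf m hm]
      ring
    calc (d / b : ℝ) ^ (m + 1) * (y - x) = d / b * ((d / b) ^ m * (y - x)) := by ring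
      _ ≤ d / b * (Int.fract (collapsedOrbit b d y m) - Int.fract (collapsedOrbit b d x m)) := by
        rw [h2]
        gcongr
      _ ≤ _ := by
        rw [← sub_nonneg]
        ring_nf
        linarith

theorem abs_collapsedOrbit_sub_le (hb : 0 < b) (hb1 : b < 1) (hd : 1 ≤ d) (x y : ℝ) (m : ℕ) :
    |collapsedOrbit b d x m - collapsedOrbit b d y m| ≤
      ((d / b) / (d / b - 1)) * (d / b) ^ m * |x - y| := by
  have hβ : 1 < d / b := by
    rw [one_lt_div hb]
    have : (1 : ℝ) ≤ d := by exact_mod_cast hd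
    linarith
  set β : ℝ := d / b with hβdef
  -- The slopes satisfy `s (m + 1) = β * s m + 1`, which gives a geometric sum.
  suffices h : |collapsedOrbit b d x m - collapsedOrbit b d y m| ≤
      (β ^ (m + 1) - 1) / (β - 1) * |x - y| by
    refine h.trans ?_
    have h0 : 0 < β - 1 := by linarith
    gcongr
    rw [div_mul_eq_mul_div]
    gcongr
    rw [pow_succ']
    linarith
  induction m with
  | zero =>
    have h0 : β - 1 ≠ 0 := by linarith
    simp [collapsedOrbit, h0]
  | succ m ih =>
    rw [collapsedOrbit_succ, collapsedOrbit_succ]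
    have h1 := abs_collapse_sub_le hb hb1 (collapsedOrbit b d x m) (collapsedOrbit b d y m)
    have h0 : β - 1 ≠ 0 := by linarith
    calc |d * collapse b (collapsedOrbit b d x m) + x
          - (d * collapse b (collapsedOrbit b d y m) + y)|
        = |d * (collapse b (collapsedOrbit b d x m) - collapse b (collapsedOrbit b d y m))
            + (x - y)| := by ring_nf
      _ ≤ d * |collapse b (collapsedOrbit b d x m) - collapse b (collapsedOrbit b d y m)|
            + |x - y| := by
          refine (abs_add_le _ _).trans ?_
          rw [abs_mul, Nat.abs_cast]
      _ ≤ d * (((β ^ (m + 1) - 1) / (β - 1) * |x - y|) / b) + |x - y| := by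
          gcongr
          exact h1.trans (by gcongr)
      _ = β * ((β ^ (m + 1) - 1) / (β - 1) * |x - y|) + |x - y| := by
          rw [hβdef]
          ring
      _ = _ := by
          field_simp
          ring

end Orbit

/-! ### Hausdorff dimension of the set of orbits avoiding the collapsed arc -/

section Dimension

variable {b : ℝ} {d : ℕ}

theorem one_lt_natCast_div (hb : 0 < b) (hb1 : b < 1) (hd : 1 ≤ d) : 1 < d / b := by
  rw [one_lt_div hb]
  exact hb1.trans_le (by exact_mod_cast hd)

/-- The sum of the integer parts of the first `m + 1` points of the collapsed orbit. Each term is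
monotone in `γ`, so two parameters with the same sum have the same integer parts throughout. -/
noncomputable def floorSum (b : ℝ) (d : ℕ) (m : ℕ) (γ : ℝ) : ℤ :=
  ∑ i ∈ Finset.range (m + 1), ⌊collapsedOrbit b d γ i⌋

theorem floorSum_mono (hb : 0 < b) (m : ℕ) : Monotone (floorSum b d m) := fun _ _ h =>
  Finset.sum_le_sum fun i _ => Int.floor_mono (collapsedOrbit_mono hb i h)

theorem floorSum_add_one (m : ℕ) (γ : ℝ) :
    floorSum b d m (γ + 1) =
      floorSum b d m γ + (∑ i ∈ Finset.range (m + 1), repunit d i : ℕ) := by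
  unfold floorSum
  rw [Nat.cast_sum, ← Finset.sum_add_distrib]
  refine Finset.sum_congr rfl fun i _ => ?_
  rw [collapsedOrbit_add_one, Int.floor_add_natCast]

theorem abs_sub_le_of_floorSum_eq (hb : 0 < b) (hd : 1 ≤ d) {m : ℕ} {x y : ℝ}
    (hx : ∀ i, Int.fract (collapsedOrbit b d x i) ≤ b)
    (hy : ∀ i, Int.fract (collapsedOrbit b d y i) ≤ b)
    (h : floorSum b d m x = floorSum b d m y) : |x - y| ≤ ((d / b : ℝ)⁻¹) ^ m := by
  wlog hxy : x ≤ y generalizing x y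
  · rw [abs_sub_comm]
    exact this hy hx h.symm (le_of_not_ge hxy)
  have hf : ∀ i < m + 1, ⌊collapsedOrbit b d x i⌋ = ⌊collapsedOrbit b d y i⌋ := fun i hi =>
    (Finset.sum_eq_sum_iff_of_le fun i _ => Int.floor_mono (collapsedOrbit_mono hb i hxy)).1 h i
      (Finset.mem_range.2 hi)
  have h1 := le_collapsedOrbit_sub hb m hxy (fun i _ => hx i) (fun i _ => hy i)
    fun i hi => hf i (by lia)
  have h2 : collapsedOrbit b d y m - collapsedOrbit b d x m ≤ 1 :=
    (abs_lt.1 (Int.abs_sub_lt_one_of_floor_eq_floor (hf m (by lia)).symm)).2.le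
  have hpos : (0 : ℝ) < d / b := div_pos (by exact_mod_cast hd) hb
  rw [abs_sub_comm, abs_of_nonneg (sub_nonneg.2 hxy), inv_pow, ← one_div,
    le_div_iff₀ (by positivity)]
  linarith

theorem sum_repunit_add_one_le (hd : 1 ≤ d) (m : ℕ) :
    ∑ i ∈ Finset.range (m + 1), repunit d i + 1 ≤ 2 * ((m + 1) ^ 2 * d ^ m) := by
  have h1 : ∑ i ∈ Finset.range (m + 1), repunit d i ≤ (m + 1) * ((m + 1) * d ^ m) := by
    refine (Finset.sum_le_card_nsmul _ _ ((m + 1) * d ^ m) fun i hi => ?_).trans (by simp)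
    have hi' : i ≤ m := Nat.lt_succ_iff.1 (Finset.mem_range.1 hi)
    exact (repunit_le hd i).trans (Nat.mul_le_mul (by lia) (Nat.pow_le_pow_right hd hi'))
  have h2 : 1 ≤ (m + 1) * ((m + 1) * d ^ m) := Nat.succ_le_of_lt (by positivity)
  calc _ ≤ (m + 1) * ((m + 1) * d ^ m) + (m + 1) * ((m + 1) * d ^ m) := by gcongr
    _ = _ := by ring

/-- The set is covered by the level sets of `floorSum b d m`, at most `2 (m + 1)² dᵐ` sets of
diameter at most `(d / b)⁻ᵐ`. -/
theorem dimH_le_of_fract_collapsedOrbit_le (hb : 0 < b) (hb1 : b < 1) (hd : 1 ≤ d) {γ₀ : ℝ}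
    {A : Set ℝ} (hA : A ⊆ Set.Icc γ₀ (γ₀ + 1))
    (hfr : ∀ γ ∈ A, ∀ m, Int.fract (collapsedOrbit b d γ m) ≤ b) :
    dimH A ≤ ENNReal.ofReal (Real.log d / Real.log (d / b)) := by
  have hβ := one_lt_natCast_div hb hb1 hd
  set β : ℝ := d / b with hβdef
  have hβ0 : 0 < β := by linarith
  have hd0 : (0 : ℝ) < d := by exact_mod_cast hd
  by_contra! hlt
  obtain ⟨t, ht1, ht2⟩ := ENNReal.lt_iff_exists_nnreal_btwn.1 hlt
  have hlogβ := Real.log_pos hβ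
  have ht : Real.log d / Real.log β < t := by
    by_contra! h
    have := ENNReal.ofReal_le_ofReal h
    rw [ENNReal.ofReal_coe_nnreal] at this
    exact absurd ht1 (not_lt.2 this)
  have htop := hausdorffMeasure_of_lt_dimH ht2
  -- The `t`-dimensional sum over the level-`m` cover is at most a quadratic factor times `q ^ m`.
  let q : ℝ := d * (β⁻¹) ^ (t : ℝ)
  have hq0 : 0 < q := mul_pos hd0 (Real.rpow_pos_of_pos (inv_pos.2 hβ0) _)
  have hq1 : q < 1 := by
    rw [div_lt_iff₀ hlogβ] at ht
    have : (d : ℝ) < β ^ (t : ℝ) := by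
      rw [← Real.log_lt_log_iff hd0 (Real.rpow_pos_of_pos hβ0 _), Real.log_rpow hβ0]
      exact ht
    simp only [q]
    rw [Real.inv_rpow hβ0.le, ← div_eq_mul_inv, div_lt_one (Real.rpow_pos_of_pos hβ0 _)]
    exact this
  have hlim : Tendsto (fun m : ℕ => 2 * (((m : ℝ) + 1) ^ 2 * q ^ m)) atTop (𝓝 0) := by
    have h1 := (tendsto_add_atTop_iff_nat 1).2
      (tendsto_pow_const_mul_const_pow_of_abs_lt_one 2 (by rwa [abs_of_pos hq0] : |q| < 1))
    have h2 := (h1.mul_const q⁻¹).const_mul 2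
    rw [zero_mul, mul_zero] at h2
    refine h2.congr fun m => ?_
    push_cast
    field_simp
    ring
  let N : ℕ → ℕ := fun m => ∑ i ∈ Finset.range (m + 1), repunit d i + 1
  let U : ∀ m, Fin (N m) → Set ℝ := fun m j =>
    {γ ∈ A | floorSum b d m γ = floorSum b d m γ₀ + (j : ℕ)}
  have hdiam : ∀ m j, Metric.ediam (U m j) ≤ ENNReal.ofReal (β⁻¹ ^ m) := by
    intro m j
    refine Metric.ediam_le fun x hx y hy => ?_
    rw [edist_dist, Real.dist_eq]
    exact ENNReal.ofReal_le_ofReal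
      (abs_sub_le_of_floorSum_eq hb hd (hfr x hx.1) (hfr y hy.1) (hx.2.trans hy.2.symm))
  have hcover : ∀ m, A ⊆ ⋃ j, U m j := by
    intro m γ hγ
    have h1 := floorSum_mono (d := d) hb m (hA hγ).1
    have h2 := floorSum_mono (d := d) hb m (hA hγ).2
    rw [floorSum_add_one] at h2
    refine Set.mem_iUnion.2 ⟨⟨(floorSum b d m γ - floorSum b d m γ₀).toNat, ?_⟩, hγ, ?_⟩
    · simp only [N]
      lia
    · simp only
      lia
  have hr : Tendsto (fun m : ℕ => ENNReal.ofReal (β⁻¹ ^ m)) atTop (𝓝 0) := by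
    rw [← ENNReal.ofReal_zero]
    exact ENNReal.tendsto_ofReal
      (tendsto_pow_atTop_nhds_zero_of_lt_one (inv_pos.2 hβ0).le (inv_lt_one_of_one_lt₀ hβ))
  have hle := MeasureTheory.Measure.hausdorffMeasure_le_liminf_sum (t : ℝ) A _ hr U
    (Eventually.of_forall hdiam) (Eventually.of_forall hcover)
  have hsum : ∀ m, ∑ j, Metric.ediam (U m j) ^ (t : ℝ) ≤
      ENNReal.ofReal (2 * (((m : ℝ) + 1) ^ 2 * q ^ m)) := by
    intro m
    calc ∑ j, Metric.ediam (U m j) ^ (t : ℝ)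
        ≤ ∑ _j : Fin (N m), ENNReal.ofReal ((β⁻¹ ^ m) ^ (t : ℝ)) := by
          refine Finset.sum_le_sum fun j _ => ?_
          rw [← ENNReal.ofReal_rpow_of_nonneg (by positivity) t.coe_nonneg]
          exact ENNReal.rpow_le_rpow (hdiam m j) t.coe_nonneg
      _ = ENNReal.ofReal (N m * (β⁻¹ ^ m) ^ (t : ℝ)) := by
          rw [Finset.sum_const, Finset.card_univ, Fintype.card_fin, nsmul_eq_mul,
            ENNReal.ofReal_mul (Nat.cast_nonneg _), ENNReal.ofReal_natCast]
      _ ≤ _ := by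
          refine ENNReal.ofReal_le_ofReal ?_
          have h1 : (N m : ℝ) ≤ 2 * (((m : ℝ) + 1) ^ 2 * d ^ m) := by
            exact_mod_cast sum_repunit_add_one_le hd m
          have h2 : (β⁻¹ ^ m) ^ (t : ℝ) = (β⁻¹ ^ (t : ℝ)) ^ m := by
            rw [← Real.rpow_natCast, ← Real.rpow_natCast, ← Real.rpow_mul (by positivity),
              ← Real.rpow_mul (by positivity), mul_comm]
          rw [h2]
          calc _ ≤ 2 * (((m : ℝ) + 1) ^ 2 * d ^ m) * (β⁻¹ ^ (t : ℝ)) ^ m := by gcongr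
            _ = _ := by
              simp only [q]
              rw [mul_pow]
              ring
  have hfin : Tendsto (fun m => ∑ j, Metric.ediam (U m j) ^ (t : ℝ)) atTop (𝓝 0) := by
    refine tendsto_of_tendsto_of_tendsto_of_le_of_le tendsto_const_nhds ?_ (fun _ => zero_le) hsum
    rw [← ENNReal.ofReal_zero]
    exact ENNReal.tendsto_ofReal hlim
  rw [hfin.liminf_eq, htop] at hle
  exact absurd hle (by simp)

/-! ### The normalised limit of the collapsed orbit -/

/-- The normalised limit of the collapsed orbit. The limit exists for `d ≥ 2`
(`tendsto_orbitGrowth`); for `d = 1` it need not, and the value is then arbitrary. -/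
noncomputable def orbitGrowth (b : ℝ) (d : ℕ) (γ : ℝ) : ℝ :=
  limUnder atTop fun m => collapsedOrbit b d γ m / d ^ m

theorem dist_collapsedOrbit_div_le (hb : 0 < b) (hd : 2 ≤ d) (γ : ℝ) (m : ℕ) :
    dist (collapsedOrbit b d γ m / d ^ m) (collapsedOrbit b d γ (m + 1) / d ^ (m + 1)) ≤
      (1 + |γ|) * ((d : ℝ)⁻¹) ^ m := by
  have hd1 : (1 : ℝ) ≤ d := by exact_mod_cast (by lia : 1 ≤ d)
  have hd0 : (0 : ℝ) < d := by linarith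
  set Y := collapsedOrbit b d γ m with hY
  have h : collapsedOrbit b d γ (m + 1) / d ^ (m + 1) - Y / d ^ m =
      ((collapse b Y - Y) + γ / d) * ((d : ℝ)⁻¹) ^ m := by
    rw [collapsedOrbit_succ, ← hY, inv_pow]
    field_simp
    ring
  rw [dist_comm, Real.dist_eq, h, abs_mul, abs_of_nonneg (by positivity : 0 ≤ ((d : ℝ)⁻¹) ^ m)]
  gcongr
  refine (abs_add_le _ _).trans (add_le_add (abs_collapse_sub_self_le hb Y) ?_)
  rw [abs_div, abs_of_pos hd0]
  exact div_le_self (abs_nonneg _) hd1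

theorem tendsto_orbitGrowth (hb : 0 < b) (hd : 2 ≤ d) (γ : ℝ) :
    Tendsto (fun m => collapsedOrbit b d γ m / d ^ m) atTop (𝓝 (orbitGrowth b d γ)) :=
  CauchySeq.tendsto_limUnder (cauchySeq_of_le_geometric _ _
    (inv_lt_one_of_one_lt₀ (by exact_mod_cast (by lia : 1 < d)))
    (dist_collapsedOrbit_div_le hb hd γ))

theorem abs_collapsedOrbit_div_sub_orbitGrowth_le (hb : 0 < b) (hd : 2 ≤ d) (γ : ℝ) (m : ℕ) :
    |collapsedOrbit b d γ m / d ^ m - orbitGrowth b d γ| ≤ 2 * (1 + |γ|) * ((d : ℝ)⁻¹) ^ m := by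
  have hd2 : (2 : ℝ) ≤ d := by exact_mod_cast hd
  have hr : (d : ℝ)⁻¹ ≤ 1 / 2 := by
    rw [inv_le_comm₀ (by linarith) (by norm_num)]
    simpa using hd2
  have h := dist_le_of_le_geometric_of_tendsto _ _ (by linarith)
    (dist_collapsedOrbit_div_le hb hd γ) (tendsto_orbitGrowth hb hd γ) m
  rw [Real.dist_eq] at h
  refine h.trans ?_
  rw [div_le_iff₀ (by linarith)]
  have : 0 ≤ (1 + |γ|) * ((d : ℝ)⁻¹) ^ m := by positivity
  nlinarith

theorem orbitGrowth_add_one_le (hb : 0 < b) (hd : 2 ≤ d) (γ : ℝ) :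
    orbitGrowth b d γ + 1 ≤ orbitGrowth b d (γ + 1) := by
  have hd0 : (0 : ℝ) < d := by exact_mod_cast (by lia : 0 < d)
  refine le_of_tendsto_of_tendsto' ((tendsto_orbitGrowth hb hd γ).add_const 1)
    (tendsto_orbitGrowth hb hd (γ + 1)) fun m => ?_
  rw [collapsedOrbit_add_one, add_div]
  gcongr
  rw [one_le_div (by positivity)]
  exact_mod_cast pow_le_repunit m

/-- After entering the collapsed arc the orbit restarts at `γ`, which gives the equation
`h = (h + d * n) / d ^ (m + 1)` for `h = orbitGrowth b d γ`. -/
theorem exists_rat_eq_orbitGrowth (hb : 0 < b) (hd : 2 ≤ d) {γ : ℝ} {m : ℕ} {n : ℤ}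
    (h : collapse b (collapsedOrbit b d γ m) = n) : ∃ q : ℚ, (q : ℝ) = orbitGrowth b d γ := by
  have hd0 : (0 : ℝ) < d := by exact_mod_cast (by lia : 0 < d)
  have hlim := tendsto_orbitGrowth hb hd γ
  have h1 : Tendsto (fun j => collapsedOrbit b d γ (j + (m + 1)) / (d : ℝ) ^ (j + (m + 1))) atTop
      (𝓝 (orbitGrowth b d γ)) :=
    (tendsto_add_atTop_iff_nat (f := fun i => collapsedOrbit b d γ i / (d : ℝ) ^ i) (m + 1)).2 hlim
  have h2 : Tendsto (fun j => collapsedOrbit b d γ (j + (m + 1)) / (d : ℝ) ^ (j + (m + 1))) atTop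
      (𝓝 ((orbitGrowth b d γ + d * n) / d ^ (m + 1))) := by
    refine ((hlim.add_const (d * n : ℝ)).div_const _).congr fun j => ?_
    rw [add_comm j, collapsedOrbit_of_collapse_eq_int h]
    field_simp
    ring
  have h3 := tendsto_nhds_unique h1 h2
  have hpow : (1 : ℝ) < d ^ (m + 1) :=
    one_lt_pow₀ (by exact_mod_cast (by lia : 1 < d)) (Nat.succ_ne_zero m)
  refine ⟨d * n / (d ^ (m + 1) - 1), ?_⟩
  push_cast
  rw [div_eq_iff (by linarith)]
  rw [eq_div_iff (by linarith)] at h3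
  linarith

/-- At step `m` the orbit is Lipschitz in the parameter with constant of order `(d / b)ᵐ`, while
`Y_m / dᵐ` is within order `d⁻ᵐ` of its limit; the exponent comes from balancing the two. -/
theorem holderOnWith_orbitGrowth (hb : 0 < b) (hb1 : b < 1) (hd : 2 ≤ d) (γ₀ : ℝ) :
    ∃ C, HolderOnWith C (Real.log d / Real.log (d / b)).toNNReal (orbitGrowth b d)
      (Set.Icc γ₀ (γ₀ + 1)) := by
  have hβ := one_lt_natCast_div hb hb1 (by lia : 1 ≤ d)
  have hlip := abs_collapsedOrbit_sub_le hb hb1 (by lia : 1 ≤ d)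
  set β : ℝ := d / b with hβdef
  have hd1 : (1 : ℝ) < d := by exact_mod_cast (by lia : 1 < d)
  have hd0 : (0 : ℝ) < d := by linarith
  have hβ0 : 0 < β := by linarith
  set r := Real.log d / Real.log β with hr
  have hr0 : 0 < r := div_pos (Real.log_pos hd1) (Real.log_pos hβ)
  have hβr : β ^ r = d := by
    rw [hr, Real.rpow_def_of_pos hβ0, mul_div_cancel₀ _ (Real.log_pos hβ).ne', Real.exp_log hd0]
  set K := 2 * (2 + |γ₀|) with hK
  have hK0 : 0 ≤ K := by positivity
  set c := β / (β - 1) with hc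
  have hc0 : 0 ≤ c := div_nonneg hβ0.le (by linarith)
  have happ : ∀ γ ∈ Set.Icc γ₀ (γ₀ + 1), ∀ m,
      |collapsedOrbit b d γ m / d ^ m - orbitGrowth b d γ| ≤ K * ((d : ℝ)⁻¹) ^ m := by
    intro γ hγ m
    refine (abs_collapsedOrbit_div_sub_orbitGrowth_le hb hd γ m).trans ?_
    have : |γ| ≤ 1 + |γ₀| := by
      rw [abs_le]
      have h1 := neg_abs_le γ₀
      have h2 := le_abs_self γ₀
      constructor <;> linarith [hγ.1, hγ.2]
    gcongr
    linarith
  have hmain : ∀ x ∈ Set.Icc γ₀ (γ₀ + 1), ∀ y ∈ Set.Icc γ₀ (γ₀ + 1),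
      |orbitGrowth b d x - orbitGrowth b d y| ≤ (2 * K + c) * d * |x - y| ^ r := by
    intro x hx y hy
    rcases eq_or_ne x y with rfl | hne
    · simp [Real.zero_rpow hr0.ne']
    have hΔ : 0 < |x - y| := abs_pos.2 (sub_ne_zero.2 hne)
    have hΔ1 : |x - y| ≤ 1 := by
      rw [abs_le]
      constructor <;> linarith [hx.1, hx.2, hy.1, hy.2]
    -- The scale at which the two orbits separate to distance about one.
    obtain ⟨m, hm1, hm2⟩ := exists_nat_pow_near (one_le_inv_iff₀.2 ⟨hΔ, hΔ1⟩) hβ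
    have h1 := happ x hx m
    have h2 := happ y hy m
    have h3 : |collapsedOrbit b d x m / d ^ m - collapsedOrbit b d y m / d ^ m| ≤
        c * ((d : ℝ)⁻¹) ^ m := by
      rw [← sub_div, abs_div, abs_of_pos (by positivity : (0 : ℝ) < d ^ m), div_eq_mul_inv, inv_pow]
      gcongr
      refine (hlip x y m).trans ?_
      rw [mul_assoc]
      refine mul_le_of_le_one_right hc0 ?_
      rwa [← le_div_iff₀ hΔ, one_div]
    have h4 : ((d : ℝ)⁻¹) ^ m ≤ d * |x - y| ^ r := by
      have h5 : |x - y|⁻¹ ^ r ≤ (d : ℝ) ^ (m + 1) := by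
        calc |x - y|⁻¹ ^ r ≤ (β ^ (m + 1)) ^ r := Real.rpow_le_rpow (by positivity) hm2.le hr0.le
          _ = (d : ℝ) ^ (m + 1) := by
            rw [← Real.rpow_natCast, ← Real.rpow_mul hβ0.le, mul_comm, Real.rpow_mul hβ0.le, hβr,
              Real.rpow_natCast]
      rw [Real.inv_rpow hΔ.le, inv_le_iff_one_le_mul₀ (Real.rpow_pos_of_pos hΔ _)] at h5
      rw [inv_pow, inv_le_iff_one_le_mul₀ (by positivity)]
      calc 1 ≤ (d : ℝ) ^ (m + 1) * |x - y| ^ r := h5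
        _ = _ := by ring
    have h5 : |orbitGrowth b d x - orbitGrowth b d y| ≤ (2 * K + c) * ((d : ℝ)⁻¹) ^ m := by
      rw [abs_le] at h1 h2 h3 ⊢
      constructor <;> linarith
    calc _ ≤ _ := h5
      _ ≤ (2 * K + c) * (d * |x - y| ^ r) := by gcongr
      _ = _ := by ring
  refine ⟨((2 * K + c) * d).toNNReal, fun x hx y hy => ?_⟩
  rw [edist_dist, edist_dist, Real.dist_eq, Real.dist_eq, Real.coe_toNNReal _ hr0.le,
    ENNReal.ofReal_rpow_of_nonneg (abs_nonneg _) hr0.le]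
  change _ ≤ ENNReal.ofReal _ * _
  rw [← ENNReal.ofReal_mul (by positivity)]
  exact ENNReal.ofReal_le_ofReal (hmain x hx y hy)

/-- The Hölder function `orbitGrowth b d` maps `A` onto an interval up to rational points. -/
theorem le_dimH_of_exists_collapse_eq_int (hb : 0 < b) (hb1 : b < 1) (hd : 1 ≤ d) {γ₀ : ℝ}
    {A : Set ℝ} (hA : A ⊆ Set.Icc γ₀ (γ₀ + 1))
    (hout : ∀ γ ∈ Set.Icc γ₀ (γ₀ + 1), γ ∉ A →
      ∃ m, ∃ n : ℤ, collapse b (collapsedOrbit b d γ m) = n) :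
    ENNReal.ofReal (Real.log d / Real.log (d / b)) ≤ dimH A := by
  -- For `d = 1` the bound is `0`, and `orbitGrowth` is not available.
  rcases hd.eq_or_lt with rfl | hd2
  · simp
  have hβ := one_lt_natCast_div hb hb1 hd
  have hr0 : 0 < Real.log d / Real.log (d / b) :=
    div_pos (Real.log_pos (by exact_mod_cast hd2)) (Real.log_pos hβ)
  obtain ⟨C, hC⟩ := holderOnWith_orbitGrowth hb hb1 hd2 γ₀
  have hcont := hC.continuousOn (Real.toNNReal_pos.2 hr0)
  set h := orbitGrowth b d
  have hsub : Set.Icc (h γ₀) (h γ₀ + 1) ⊆ h '' A ∪ Set.range ((↑) : ℚ → ℝ) := by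
    intro z hz
    have hz' : z ∈ Set.Icc (h γ₀) (h (γ₀ + 1)) :=
      ⟨hz.1, hz.2.trans (orbitGrowth_add_one_le hb hd2 γ₀)⟩
    obtain ⟨γ, hγ, rfl⟩ := intermediate_value_Icc (by linarith) hcont hz'
    by_cases hγA : γ ∈ A
    · exact Or.inl ⟨γ, hγA, rfl⟩
    · obtain ⟨m, n, hmn⟩ := hout γ hγ hγA
      exact Or.inr (exists_rat_eq_orbitGrowth hb hd2 hmn)
  have hdim : 1 ≤ dimH (h '' A) := by
    have h1 := dimH_mono hsub
    rw [dimH_union, dimH_countable (Set.countable_range _), max_eq_left zero_le,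
      Real.dimH_of_nonempty_interior (by
        rw [interior_Icc]
        exact Set.nonempty_Ioo.2 (by linarith))] at h1
    simpa using h1
  have h2 := hdim.trans ((hC.mono hA).dimH_image_le (Real.toNNReal_pos.2 hr0))
  rw [ENNReal.le_div_iff_mul_le (Or.inl (by simpa using hr0)) (Or.inl ENNReal.coe_ne_top),
    one_mul] at h2
  exact h2

end Dimension

/-! ### One-sided critical orbits and their gap -/

section Matching

variable {β α : ℝ}

/-- The left-continuous version of `T_α`, with values in `(0, 1]`; its iterates at `1` are the left
limits `T_α^m(0⁻)`. -/
noncomputable def genBetaLeft (β α x : ℝ) : ℝ := β * x + α - (⌈β * x + α⌉ - 1)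

theorem genBetaLeft_mem (x : ℝ) : 0 < genBetaLeft β α x ∧ genBetaLeft β α x ≤ 1 := by
  unfold genBetaLeft
  constructor <;> linarith [Int.le_ceil (β * x + α), Int.ceil_lt_add_one (β * x + α)]

theorem tendsto_genBeta_nhdsGT (hβ : 0 < β) (x : ℝ) :
    Tendsto (genBeta β α) (𝓝[>] x) (𝓝[>] (genBeta β α x)) := by
  have hc : Tendsto (fun y => β * y + α) (𝓝[>] x) (𝓝 (β * x + α)) :=
    (Continuous.tendsto (by fun_prop) x).mono_left nhdsWithin_le_nhds
  have hev : (fun y => β * y + α - ⌊β * x + α⌋) =ᶠ[𝓝[>] x] genBeta β α := by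
    filter_upwards [hc.eventually (gt_mem_nhds (Int.lt_floor_add_one (β * x + α))),
      self_mem_nhdsWithin] with y hy hxy
    have hxy : x < y := hxy
    have hf : ⌊β * y + α⌋ = ⌊β * x + α⌋ := by
      rw [Int.floor_eq_iff]
      exact ⟨(Int.floor_le _).trans (by gcongr), hy⟩
    simp only [genBeta, Int.fract, hf]
  refine (tendsto_nhdsWithin_iff.2 ⟨hc.sub_const _, ?_⟩).congr' hev
  filter_upwards [self_mem_nhdsWithin] with y hxy
  have hxy : x < y := hxy
  simp only [genBeta, Int.fract, Set.mem_Ioi]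
  gcongr

theorem tendsto_genBeta_nhdsLT (hβ : 0 < β) (x : ℝ) :
    Tendsto (genBeta β α) (𝓝[<] x) (𝓝[<] (genBetaLeft β α x)) := by
  have hc : Tendsto (fun y => β * y + α) (𝓝[<] x) (𝓝 (β * x + α)) :=
    (Continuous.tendsto (by fun_prop) x).mono_left nhdsWithin_le_nhds
  have hlt : (⌈β * x + α⌉ : ℝ) - 1 < β * x + α := by linarith [Int.ceil_lt_add_one (β * x + α)]
  have hev : (fun y => β * y + α - (⌈β * x + α⌉ - 1)) =ᶠ[𝓝[<] x] genBeta β α := by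
    filter_upwards [hc.eventually (lt_mem_nhds hlt), self_mem_nhdsWithin] with y hy hxy
    have hxy : y < x := hxy
    have hf : ⌊β * y + α⌋ = ⌈β * x + α⌉ - 1 := by
      rw [Int.floor_eq_iff]
      push_cast
      refine ⟨hy.le, ?_⟩
      have : β * y + α < β * x + α := by gcongr
      linarith [Int.le_ceil (β * x + α)]
    simp only [genBeta, Int.fract, hf]
    push_cast
    rfl
  refine (tendsto_nhdsWithin_iff.2 ⟨hc.sub_const _, ?_⟩).congr' hev
  filter_upwards [self_mem_nhdsWithin] with y hxy
  have hxy : y < x := hxy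
  simp only [genBetaLeft, Set.mem_Iio]
  gcongr

theorem tendsto_iterate_genBeta_nhdsGT (hβ : 0 < β) (m : ℕ) (x : ℝ) :
    Tendsto (genBeta β α)^[m] (𝓝[>] x) (𝓝[>] ((genBeta β α)^[m] x)) := by
  induction m generalizing x with
  | zero => exact tendsto_id
  | succ m ih => exact (ih _).comp (tendsto_genBeta_nhdsGT hβ x)

theorem tendsto_iterate_genBeta_nhdsLT (hβ : 0 < β) (m : ℕ) (x : ℝ) :
    Tendsto (genBeta β α)^[m] (𝓝[<] x) (𝓝[<] ((genBetaLeft β α)^[m] x)) := by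
  induction m generalizing x with
  | zero => exact tendsto_id
  | succ m ih => exact (ih _).comp (tendsto_genBeta_nhdsLT hβ x)

/-- The difference `T_α^m(0⁻) - T_α^m(0⁺)`, with `T_α^m(0⁻)` represented in `(0, 1]` and
`T_α^m(0⁺)` in `[0, 1)`. -/
noncomputable def orbitGap (β α : ℝ) (m : ℕ) : ℝ :=
  (genBetaLeft β α)^[m] 1 - (genBeta β α)^[m] 0

theorem hasMatching_iff (hβ : 0 < β) :
    HasMatching β α ↔ ∃ m : ℕ, ∃ n : ℤ, orbitGap β α (m + 1) = n := by
  have hR := fun m => (tendsto_iterate_genBeta_nhdsGT (α := α) hβ m 0).mono_right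
    nhdsWithin_le_nhds
  have hL := fun m => (tendsto_iterate_genBeta_nhdsLT (α := α) hβ m 1).mono_right
    nhdsWithin_le_nhds
  have hcircle : ∀ a b : ℝ, (a : AddCircle (1 : ℝ)) = b ↔ ∃ n : ℤ, b - a = n := by
    intro a b
    rw [eq_comm, ← sub_eq_zero, ← AddCircle.coe_sub, AddCircle.coe_eq_zero_iff]
    simp [eq_comm]
  constructor
  · rintro ⟨m, hm, a, b, ha, hb, hab⟩
    obtain ⟨m, rfl⟩ := Nat.exists_eq_add_of_le' hm
    obtain ⟨n, hn⟩ := (hcircle a b).1 hab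
    refine ⟨m, n, ?_⟩
    rw [orbitGap, ← tendsto_nhds_unique ha (hR _), ← tendsto_nhds_unique hb (hL _), hn]
  · rintro ⟨m, n, h⟩
    exact ⟨m + 1, by lia, _, _, hR _, hL _, (hcircle _ _).2 ⟨n, h⟩⟩

theorem iterate_genBeta_mem (m : ℕ) :
    0 ≤ (genBeta β α)^[m] 0 ∧ (genBeta β α)^[m] 0 < 1 := by
  cases m with
  | zero => simp
  | succ m =>
    rw [Function.iterate_succ_apply']
    exact ⟨Int.fract_nonneg _, Int.fract_lt_one _⟩

theorem iterate_genBetaLeft_mem (m : ℕ) :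
    0 < (genBetaLeft β α)^[m] 1 ∧ (genBetaLeft β α)^[m] 1 ≤ 1 := by
  cases m with
  | zero => simp
  | succ m =>
    rw [Function.iterate_succ_apply']
    exact genBetaLeft_mem _

theorem orbitGap_zero : orbitGap β α 0 = 1 := by simp [orbitGap]

theorem orbitGap_succ (m : ℕ) : ∃ n : ℤ, orbitGap β α (m + 1) = β * orbitGap β α m + n := by
  refine ⟨⌊β * (genBeta β α)^[m] 0 + α⌋ - (⌈β * (genBetaLeft β α)^[m] 1 + α⌉ - 1), ?_⟩
  simp only [orbitGap, Function.iterate_succ_apply', genBeta, genBetaLeft, Int.fract]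
  push_cast
  ring

theorem abs_orbitGap_le (m : ℕ) : |orbitGap β α m| ≤ 1 := by
  have h1 := iterate_genBeta_mem (β := β) (α := α) m
  have h2 := iterate_genBetaLeft_mem (β := β) (α := α) m
  unfold orbitGap
  rw [abs_le]
  constructor <;> linarith

/-- If the gap is `-s` modulo `1`, the position of `T_α^m(0⁺)` relative to `s` decides its value. -/
theorem orbitGap_eq_or {s : ℝ} (hs0 : 0 < s) (hs1 : s < 1) {m : ℕ}
    (h : ∃ n : ℤ, orbitGap β α m = -s + n) :
    ((genBeta β α)^[m] 0 ≤ s ∧ orbitGap β α m = 1 - s) ∨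
      (s < (genBeta β α)^[m] 0 ∧ orbitGap β α m = -s) := by
  obtain ⟨n, hn⟩ := h
  have h1 := iterate_genBeta_mem (β := β) (α := α) m
  have h2 := iterate_genBetaLeft_mem (β := β) (α := α) m
  have h3 : (genBetaLeft β α)^[m] 1 = (genBeta β α)^[m] 0 - s + n := by
    rw [orbitGap] at hn
    linarith
  rw [h3] at h2
  rcases le_or_gt ((genBeta β α)^[m] 0) s with hu | hu
  · have h4 : (0 : ℝ) < n := by linarith
    have h5 : (n : ℝ) < 2 := by linarith
    obtain rfl : n = 1 := le_antisymm (Int.lt_add_one_iff.1 (by exact_mod_cast h5))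
      (by exact_mod_cast h4)
    refine Or.inl ⟨hu, ?_⟩
    push_cast at hn
    linarith
  · have h4 : (-1 : ℝ) < n := by linarith
    have h5 : (n : ℝ) < 1 := by linarith
    obtain rfl : n = 0 := le_antisymm (Int.lt_add_one_iff.1 (by exact_mod_cast h5))
      (Int.add_one_le_iff.2 (by exact_mod_cast h4))
    refine Or.inr ⟨hu, ?_⟩
    push_cast at hn
    linarith

/-- The gap at step `m` is the value at `β` of a monic integer polynomial of degree `m`. -/
theorem isIntegral_of_orbitGap_eq_int {m : ℕ} {n : ℤ} (h : orbitGap β α (m + 1) = n) :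
    IsIntegral ℤ β := by
  open Polynomial in
  have key : ∀ m, ∃ p : ℤ[X], p.Monic ∧ p.natDegree = m ∧ aeval β p = orbitGap β α m := by
    intro m
    induction m with
    | zero => exact ⟨1, monic_one, natDegree_one, by simp [orbitGap_zero]⟩
    | succ m ih =>
      obtain ⟨p, hp, hdeg, hval⟩ := ih
      obtain ⟨n, hn⟩ := orbitGap_succ (β := β) (α := α) m
      have hXp : (X * p).natDegree = m + 1 := by
        rw [natDegree_X_mul hp.ne_zero, hdeg]
      have hlt : (C n).degree < (X * p).degree := by
        rw [degree_eq_natDegree (monic_X.mul hp).ne_zero, hXp]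
        exact degree_C_le.trans_lt (by exact_mod_cast Nat.succ_pos m)
      refine ⟨X * p + C n, (monic_X.mul hp).add_of_left hlt, ?_, ?_⟩
      · rw [natDegree_add_C, hXp]
      · rw [hn]
        simp [hval]
  obtain ⟨p, hp, hdeg, hval⟩ := key (m + 1)
  refine ⟨p - Polynomial.C n, hp.sub_of_left ?_, ?_⟩
  · rw [Polynomial.degree_eq_natDegree hp.ne_zero, hdeg]
    exact Polynomial.degree_C_le.trans_lt (by exact_mod_cast Nat.succ_pos m)
  · rw [← Polynomial.aeval_def]
    simp [hval, h]

/-- If the conjugate `a - β` of `β` has modulus greater than `1`, the gap never becomes rational. -/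
theorem orbitGap_eq_int_combination {a b : ℤ} (heq : β ^ 2 - a * β + b = 0) (hc : 1 < |a - β|)
    (m : ℕ) : ∃ x y : ℤ, orbitGap β α (m + 1) = x + y * β ∧ y ≠ 0 := by
  induction m with
  | zero =>
    obtain ⟨n, hn⟩ := orbitGap_succ (β := β) (α := α) 0
    refine ⟨n, 1, ?_, one_ne_zero⟩
    rw [hn, orbitGap_zero]
    push_cast
    ring
  | succ m ih =>
    obtain ⟨x, y, hxy, hy⟩ := ih
    obtain ⟨n, hn⟩ := orbitGap_succ (β := β) (α := α) (m + 1)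
    refine ⟨n - b * y, x + a * y, ?_, fun h0 => ?_⟩
    · rw [hn, hxy]
      push_cast
      linear_combination (y : ℝ) * heq
    · -- The coefficient of `β` is `(a - β) * y` plus the gap, and `|(a - β) * y| > 1`.
      have h1 : (a - β) * y = -orbitGap β α (m + 1) := by
        have h0' : (x : ℝ) + a * y = 0 := by exact_mod_cast h0
        rw [hxy]
        linear_combination h0'
      have h2 : (1 : ℝ) ≤ |(y : ℝ)| := by exact_mod_cast Int.one_le_abs hy
      have h3 : |a - β| * |(y : ℝ)| ≤ 1 := by
        rw [← abs_mul, h1, abs_neg]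
        exact abs_orbitGap_le _
      nlinarith

end Matching

/-! ### Non-matching in terms of the collapsed orbit -/

section Coding

variable {β α b γ : ℝ} {d : ℕ}

/-- Up to integers, the `m`-th point of the collapsed orbit is `T_α^(m+1)(0⁺) + w`, and the gap at
step `m + 1` is `-s`. The index is shifted because the collapsed orbit starts at the parameter. -/
def OrbitsAligned (β α b : ℝ) (d : ℕ) (γ w s : ℝ) (m : ℕ) : Prop :=
  (∃ n : ℤ, collapsedOrbit b d γ m = (genBeta β α)^[m + 1] 0 + w + n) ∧
    ∃ n : ℤ, orbitGap β α (m + 1) = -s + n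

theorem OrbitsAligned.orbitGap_ne_int {w s : ℝ} {m : ℕ} (h : OrbitsAligned β α b d γ w s m)
    (hs0 : 0 < s) (hs1 : s < 1) (n : ℤ) : orbitGap β α (m + 1) ≠ n := by
  intro hn
  rcases orbitGap_eq_or hs0 hs1 h.2 with ⟨-, h1⟩ | ⟨-, h1⟩
  · have h2 : (0 : ℝ) < n := by linarith
    have h3 : (n : ℝ) < 1 := by linarith
    norm_cast at h2 h3
    lia
  · have h2 : (-1 : ℝ) < n := by linarith
    have h3 : (n : ℝ) < 0 := by linarith
    norm_cast at h2 h3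
    lia

theorem collapsedOrbit_succ_of_fract_le (hb : 0 < b) (hbβ : d = b * β) {m : ℕ}
    (h : Int.fract (collapsedOrbit b d γ m) ≤ b) :
    collapsedOrbit b d γ (m + 1) =
      β * Int.fract (collapsedOrbit b d γ m) + γ + (d * ⌊collapsedOrbit b d γ m⌋ : ℤ) := by
  rw [collapsedOrbit_succ, collapse_of_fract_le hb h]
  push_cast
  rw [mul_add, mul_div_assoc', hbβ]
  field_simp
  ring

theorem iterate_genBeta_succ (m : ℕ) : ∃ n : ℤ,
    (genBeta β α)^[m + 1] 0 = β * (genBeta β α)^[m] 0 + α + n := by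
  refine ⟨-⌊β * (genBeta β α)^[m] 0 + α⌋, ?_⟩
  rw [Function.iterate_succ_apply', genBeta, Int.fract]
  push_cast
  ring

/-- With no translation, `T_α^(m+1)(0⁺) ≤ b` propagates the alignment; otherwise the gap at step
`m + 1` is `-b`, and the next one is an integer because `b * β = d`. -/
theorem OrbitsAligned.step_zero (hb : 0 < b) (hb1 : b < 1) (hbβ : d = b * β) {w s : ℝ} {m : ℕ}
    (hγ : γ = α + w) (hs : ∃ k : ℤ, β = k - s) (h : OrbitsAligned β α b d γ 0 b m) :
    (Int.fract (collapsedOrbit b d γ m) ≤ b ∧ OrbitsAligned β α b d γ w s (m + 1)) ∨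
      ((∃ n : ℤ, orbitGap β α (m + 2) = n) ∧
        ¬(0 < Int.fract (collapsedOrbit b d γ m) ∧ Int.fract (collapsedOrbit b d γ m) < b)) := by
  obtain ⟨k, hk⟩ := hs
  obtain ⟨⟨n, hn⟩, hgap⟩ := h
  obtain ⟨i, hi⟩ := orbitGap_succ (β := β) (α := α) (m + 1)
  obtain ⟨j, hj⟩ := iterate_genBeta_succ (β := β) (α := α) (m + 1)
  have hfr : Int.fract (collapsedOrbit b d γ m) = (genBeta β α)^[m + 1] 0 := by
    rw [hn, add_zero, Int.fract_add_intCast]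
    exact Int.fract_eq_self.2 (iterate_genBeta_mem _)
  rcases orbitGap_eq_or hb hb1 hgap with ⟨hu, hg⟩ | ⟨hu, hg⟩
  · have hle : Int.fract (collapsedOrbit b d γ m) ≤ b := hfr.trans_le hu
    refine Or.inl ⟨hle, ⟨d * ⌊collapsedOrbit b d γ m⌋ - j, ?_⟩, k - d + i, ?_⟩
    · rw [collapsedOrbit_succ_of_fract_le hb hbβ hle, hfr, hj, hγ]
      push_cast
      ring
    · rw [hi, hg]
      push_cast
      linear_combination hk + hbβ
  · refine Or.inr ⟨⟨-d + i, ?_⟩, fun h => absurd (hfr ▸ h.2) (not_lt.2 hu.le)⟩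
    rw [hi, hg]
    push_cast
    linear_combination hbβ

/-- With translation by `b`, `T_α^(m+1)(0⁺) > 1 - b` propagates the alignment; otherwise the gap at
step `m + 1` is `b`, and the next one is an integer because `b * β = d`. -/
theorem OrbitsAligned.step_shift (hb : 0 < b) (hb1 : b < 1) (hbβ : d = b * β) {m : ℕ}
    (hγ : γ = α + b) (hk : ∃ k : ℤ, β = k + b) (h : OrbitsAligned β α b d γ b (1 - b) m) :
    (Int.fract (collapsedOrbit b d γ m) ≤ b ∧ OrbitsAligned β α b d γ 0 b (m + 1)) ∨
      ((∃ n : ℤ, orbitGap β α (m + 2) = n) ∧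
        ¬(0 < Int.fract (collapsedOrbit b d γ m) ∧ Int.fract (collapsedOrbit b d γ m) < b)) := by
  obtain ⟨k, hk⟩ := hk
  obtain ⟨⟨n, hn⟩, hgap⟩ := h
  obtain ⟨i, hi⟩ := orbitGap_succ (β := β) (α := α) (m + 1)
  obtain ⟨j, hj⟩ := iterate_genBeta_succ (β := β) (α := α) (m + 1)
  have hu01 := iterate_genBeta_mem (β := β) (α := α) (m + 1)
  have hfr : Int.fract (collapsedOrbit b d γ m) = Int.fract ((genBeta β α)^[m + 1] 0 + b) := by
    rw [hn, Int.fract_add_intCast]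
  rcases orbitGap_eq_or (by linarith) (by linarith) hgap with ⟨hu, hg⟩ | ⟨hu, hg⟩
  · refine Or.inr ⟨⟨d + i, ?_⟩, ?_⟩
    · rw [hi, hg]
      push_cast
      linear_combination -hbβ
    · rw [hfr]
      rintro ⟨h1, h2⟩
      rcases hu.eq_or_lt with h3 | h3
      · rw [h3] at h1
        simp at h1
      · rw [Int.fract_eq_self.2 ⟨by linarith, by linarith⟩] at h2
        linarith
  · have hfr' : Int.fract (collapsedOrbit b d γ m) = (genBeta β α)^[m + 1] 0 + b - 1 := by
      rw [hfr, Int.fract_eq_iff]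
      exact ⟨by linarith, by linarith, 1, by push_cast; ring⟩
    have hle : Int.fract (collapsedOrbit b d γ m) ≤ b := by linarith
    refine Or.inl ⟨hle, ⟨d * ⌊collapsedOrbit b d γ m⌋ - j - k + d, ?_⟩, -k + d + i, ?_⟩
    · rw [collapsedOrbit_succ_of_fract_le hb hbβ hle, hfr', hj, hγ]
      push_cast
      linear_combination -hk - hbβ
    · rw [hi, hg]
      push_cast
      linear_combination -hk - hbβ

/-- An alignment `P` that persists until matching occurs describes the non-matching parameters, up
to endpoints of the arc, as those whose collapsed orbit stays in it. -/
theorem not_hasMatching_coding {P : ℕ → Prop} (hβ : 0 < β) (h0 : P 0)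
    (hne : ∀ m, P m → ∀ n : ℤ, orbitGap β α (m + 1) ≠ n)
    (hstep : ∀ m, P m → (Int.fract (collapsedOrbit b d γ m) ≤ b ∧ P (m + 1)) ∨
      ((∃ n : ℤ, orbitGap β α (m + 2) = n) ∧
        ¬(0 < Int.fract (collapsedOrbit b d γ m) ∧ Int.fract (collapsedOrbit b d γ m) < b))) :
    (¬HasMatching β α → ∀ m, Int.fract (collapsedOrbit b d γ m) ≤ b) ∧
      ((∀ m, 0 < Int.fract (collapsedOrbit b d γ m) ∧ Int.fract (collapsedOrbit b d γ m) < b) →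
        ¬HasMatching β α) := by
  rw [hasMatching_iff hβ]
  constructor
  · intro hno
    have hP : ∀ m, P m := by
      intro m
      induction m with
      | zero => exact h0
      | succ m ih =>
        rcases hstep m ih with h | h
        · exact h.2
        · exact absurd ⟨m + 1, h.1⟩ hno
    intro m
    rcases hstep m (hP m) with h | h
    · exact h.1
    · exact absurd ⟨m + 1, h.1⟩ hno
  · intro hfr
    have hP : ∀ m, P m := by
      intro m
      induction m with
      | zero => exact h0
      | succ m ih =>
        rcases hstep m ih with h | h
        · exact h.2
        · exact absurd (hfr m) h.2
    rintro ⟨m, n, h⟩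
    exact hne m (hP m) n h

theorem OrbitsAligned.zero {w s : ℝ} (hγ : γ = α + w) (hs : ∃ k : ℤ, β = k - s) :
    OrbitsAligned β α b d γ w s 0 := by
  obtain ⟨k, hk⟩ := hs
  obtain ⟨i, hi⟩ := orbitGap_succ (β := β) (α := α) 0
  obtain ⟨j, hj⟩ := iterate_genBeta_succ (β := β) (α := α) 0
  refine ⟨⟨-j, ?_⟩, k + i, ?_⟩
  · rw [hj, collapsedOrbit, hγ, Function.iterate_zero, id]
    push_cast
    ring
  · rw [hi, orbitGap_zero]
    push_cast
    linear_combination hk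

/-- The case of a positive conjugate `b = k - β`. -/
theorem coding_of_add_eq_int (hb : 0 < b) (hb1 : b < 1) (hβ : 0 < β) (hbβ : d = b * β) {k : ℤ}
    (hk : β + b = k) (α : ℝ) :
    (¬HasMatching β α → ∀ m, Int.fract (collapsedOrbit b d (α + 0) m) ≤ b) ∧
      ((∀ m, 0 < Int.fract (collapsedOrbit b d (α + 0) m) ∧
        Int.fract (collapsedOrbit b d (α + 0) m) < b) → ¬HasMatching β α) :=
  not_hasMatching_coding (P := OrbitsAligned β α b d (α + 0) 0 b) hβ
    (.zero rfl ⟨k, by linarith⟩) (fun _ h => h.orbitGap_ne_int hb hb1)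
    fun _ h => h.step_zero hb hb1 hbβ rfl ⟨k, by linarith⟩

/-- The case of a negative conjugate `-b = k - β`, where the translation of the collapsed orbit
alternates between `b` and `0`. -/
theorem coding_of_sub_eq_int (hb : 0 < b) (hb1 : b < 1) (hβ : 0 < β) (hbβ : d = b * β) {k : ℤ}
    (hk : β - b = k) (α : ℝ) :
    (¬HasMatching β α → ∀ m, Int.fract (collapsedOrbit b d (α + b) m) ≤ b) ∧
      ((∀ m, 0 < Int.fract (collapsedOrbit b d (α + b) m) ∧
        Int.fract (collapsedOrbit b d (α + b) m) < b) → ¬HasMatching β α) := by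
  have hs : ∃ k : ℤ, β = k - (1 - b) := ⟨k + 1, by push_cast; linarith⟩
  refine not_hasMatching_coding (P := fun m => OrbitsAligned β α b d (α + b) 0 b m ∨
    OrbitsAligned β α b d (α + b) b (1 - b) m) hβ (Or.inr (.zero rfl hs)) ?_ ?_
  · rintro m (h | h)
    · exact h.orbitGap_ne_int hb hb1
    · exact h.orbitGap_ne_int (by linarith) (by linarith)
  · rintro m (h | h)
    · exact (h.step_zero hb hb1 hbβ rfl hs).imp_left fun h => ⟨h.1, Or.inr h.2⟩
    · exact (h.step_shift hb hb1 hbβ rfl ⟨k, by linarith⟩).imp_left fun h => ⟨h.1, Or.inl h.2⟩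

theorem dimH_nonMatchingSet_of_coding (hb : 0 < b) (hb1 : b < 1) (hd : 1 ≤ d) (hbβ : d = b * β)
    (w : ℝ) (h : ∀ α,
      (¬HasMatching β α → ∀ m, Int.fract (collapsedOrbit b d (α + w) m) ≤ b) ∧
      ((∀ m, 0 < Int.fract (collapsedOrbit b d (α + w) m) ∧
        Int.fract (collapsedOrbit b d (α + w) m) < b) → ¬HasMatching β α)) :
    dimH (nonMatchingSet β) = ENNReal.ofReal (Real.log d / Real.log β) := by
  have hβ : β = d / b := by
    rw [hbβ]
    field_simp
  have hiso := (IsometryEquiv.addRight w).dimH_image (nonMatchingSet β)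
  have hmem : ∀ γ, γ ∈ IsometryEquiv.addRight w '' nonMatchingSet β ↔
      γ - w ∈ nonMatchingSet β := by
    intro γ
    constructor
    · rintro ⟨α, hα, rfl⟩
      simpa using hα
    · intro hγ
      exact ⟨γ - w, hγ, by simp⟩
  have hsub : IsometryEquiv.addRight w '' nonMatchingSet β ⊆ Set.Icc w (w + 1) := by
    intro γ hγ
    have := ((hmem γ).1 hγ).1
    constructor <;> linarith [this.1, this.2]
  rw [← hiso]
  conv_rhs => rw [hβ]
  refine le_antisymm (dimH_le_of_fract_collapsedOrbit_le hb hb1 hd hsub fun γ hγ => ?_)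
    (le_dimH_of_exists_collapse_eq_int hb hb1 hd hsub fun γ hγI hγ => ?_)
  · simpa using (h (γ - w)).1 ((hmem γ).1 hγ).2
  · by_contra! hno
    refine hγ ((hmem γ).2 ⟨⟨by linarith [hγI.1], by linarith [hγI.2]⟩,
      (h (γ - w)).2 fun m => ?_⟩)
    by_contra hm
    rw [sub_add_cancel] at hm
    obtain ⟨n, hn⟩ := exists_int_eq_collapse hb hm
    exact hno m n hn

end Coding

/-! ### Quadratic Pisot numbers -/

section Pisot

variable {β : ℝ}

theorem ne_ratCast_of_natDegree_minpoly (hquad : (minpoly ℚ β).natDegree = 2) (q : ℚ) :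
    β ≠ q := by
  rintro rfl
  have : minpoly ℚ (q : ℝ) = _ := minpoly.eq_X_sub_C ℝ q
  rw [this, Polynomial.natDegree_X_sub_C] at hquad
  norm_num at hquad

open Polynomial in
theorem exists_quadratic_of_isIntegral (hint : IsIntegral ℤ β)
    (hquad : (minpoly ℚ β).natDegree = 2) : ∃ a b : ℤ, β ^ 2 - a * β + b = 0 := by
  have h1 := minpoly.isIntegrallyClosed_eq_field_fractions' ℚ hint
  have hmon := minpoly.monic hint
  have hdeg : (minpoly ℤ β).natDegree = 2 := by
    rw [← hquad, h1, hmon.natDegree_map]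
  have h2 := minpoly.aeval ℤ β
  rw [aeval_eq_sum_range, hdeg, Finset.sum_range_succ, Finset.sum_range_succ,
    Finset.sum_range_one] at h2
  have h3 : (minpoly ℤ β).coeff 2 = 1 := hdeg ▸ hmon.coeff_natDegree
  refine ⟨-(minpoly ℤ β).coeff 1, (minpoly ℤ β).coeff 0, ?_⟩
  simp only [h3, zsmul_eq_mul] at h2
  push_cast at h2 ⊢
  linarith

open Polynomial in
theorem isPisot_iff_of_quadratic (hβ : 1 < β) (hquad : (minpoly ℚ β).natDegree = 2) {a b : ℤ}
    (heq : β ^ 2 - a * β + b = 0) : IsPisot β ↔ |a - β| < 1 := by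
  have hint : IsIntegral ℤ β := by
    refine ⟨X ^ 2 - C a * X + C b, by monicity!, ?_⟩
    simp only [eval₂_add, eval₂_sub, eval₂_mul, eval₂_pow, eval₂_X, eval₂_C]
    simpa using heq
  have h0 : minpoly ℚ β ≠ 0 := by
    intro h
    simp [h] at hquad
  have hmin : minpoly ℚ β = X ^ 2 - C (a : ℚ) * X + C (b : ℚ) := by
    refine (minpoly.unique_of_degree_le_degree_minpoly ℚ β (by monicity!)
      (by simpa using heq) ?_).symm
    rw [degree_eq_natDegree h0, hquad]
    compute_degree!
  have hroot : ∀ z : ℂ, z ∈ (minpoly ℚ β).aroots ℂ ↔ z = β ∨ z = ((a - β : ℝ) : ℂ) := by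
    intro z
    have heq' : (β : ℂ) ^ 2 - a * β + b = 0 := by exact_mod_cast heq
    rw [mem_aroots, and_iff_right h0, hmin]
    have h : aeval z (X ^ 2 - C (a : ℚ) * X + C (b : ℚ)) =
        (z - β) * (z - ((a - β : ℝ) : ℂ)) := by
      simp
      linear_combination heq'
    rw [h, mul_eq_zero, sub_eq_zero, sub_eq_zero]
  have hne : ((a - β : ℝ) : ℂ) ≠ β := by
    intro h
    have h1 : (a : ℝ) - β = β := by exact_mod_cast h
    refine ne_ratCast_of_natDegree_minpoly hquad (a / 2) ?_
    push_cast
    linarith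
  constructor
  · rintro ⟨-, -, h⟩
    have := h _ ((hroot _).2 (Or.inr rfl)) hne
    rwa [Complex.norm_real, Real.norm_eq_abs] at this
  · refine fun h => ⟨hβ, hint, fun z hz hzβ => ?_⟩
    rcases (hroot z).1 hz with rfl | rfl
    · exact absurd rfl hzβ
    · rwa [Complex.norm_real, Real.norm_eq_abs]

theorem HasMatching.isPisot {α : ℝ} (hβ : 1 < β) (hquad : (minpoly ℚ β).natDegree = 2)
    (h : HasMatching β α) : IsPisot β := by
  obtain ⟨m, n, hmn⟩ := (hasMatching_iff (by linarith)).1 h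
  obtain ⟨a, b, heq⟩ := exists_quadratic_of_isIntegral (isIntegral_of_orbitGap_eq_int hmn) hquad
  rw [isPisot_iff_of_quadratic hβ hquad heq]
  have hirr := ne_ratCast_of_natDegree_minpoly hquad
  by_contra! hge
  rcases hge.eq_or_lt with h1 | h1
  · rcases eq_or_eq_neg_of_abs_eq h1.symm with h2 | h2
    · exact hirr (a - 1) (by push_cast; linarith)
    · exact hirr (a + 1) (by push_cast; linarith)
  · obtain ⟨x, y, hxy, hy⟩ := orbitGap_eq_int_combination (α := α) heq h1 m
    have hy' : (y : ℝ) ≠ 0 := by exact_mod_cast hy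
    refine hirr ((n - x) / y) ?_
    push_cast
    rw [eq_div_iff hy']
    linarith

/-- The number `b` is the modulus of the conjugate of `β`; the inequality between `k` and `d` says
that the quadratic polynomial has the right sign at `1`, respectively at `-1`. -/
theorem IsPisotEquation.exists_conjugate {k d : ℕ} (hβ : 1 < β) (h : IsPisotEquation β k d) :
    ∃ b : ℝ, 0 < b ∧ b < 1 ∧ d = b * β ∧ (β + b = k ∨ β - b = k) := by
  obtain ⟨-, hd, ⟨heq, hk⟩ | ⟨heq, hk⟩⟩ := h
  · have hd' : (1 : ℝ) ≤ d := by exact_mod_cast hd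
    have hb : (d : ℝ) = (k - β) * β := by linear_combination heq
    refine ⟨k - β, by nlinarith, ?_, hb, Or.inl (by ring)⟩
    by_contra! h1
    nlinarith
  · have hd' : (1 : ℝ) ≤ d := by exact_mod_cast hd
    have hb : (d : ℝ) = (β - k) * β := by linear_combination -heq
    refine ⟨β - k, by nlinarith, ?_, hb, Or.inr (by ring)⟩
    by_contra! h1
    nlinarith

theorem IsPisotEquation.isPisot {k d : ℕ} (hβ : 1 < β) (hquad : (minpoly ℚ β).natDegree = 2)
    (h : IsPisotEquation β k d) : IsPisot β := by
  obtain ⟨b, hb, hb1, hbd, hk | hk⟩ := h.exists_conjugate hβ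
  · rw [isPisot_iff_of_quadratic hβ hquad (a := k) (b := d), abs_lt]
    · push_cast
      constructor <;> linarith
    · push_cast
      linear_combination hbd + β * hk
  · rw [isPisot_iff_of_quadratic hβ hquad (a := k) (b := -d), abs_lt]
    · push_cast
      constructor <;> linarith
    · push_cast
      linear_combination -hbd + β * hk

theorem IsPisot.exists_isPisotEquation (hβ : 1 < β) (hquad : (minpoly ℚ β).natDegree = 2)
    (h : IsPisot β) : ∃ k d : ℕ, IsPisotEquation β k d := by
  obtain ⟨a, b, heq⟩ := exists_quadratic_of_isIntegral h.2.1 hquad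
  have hc := (isPisot_iff_of_quadratic hβ hquad heq).1 h
  rw [abs_lt] at hc
  have hprod : (b : ℝ) = (a - β) * β := by linear_combination heq
  have hβ0 : 0 < β := by linarith
  have ha : 0 < a := by
    have : (0 : ℝ) < a := by linarith
    exact_mod_cast this
  have hb : b ≠ 0 := by
    rintro rfl
    rw [Int.cast_zero, zero_eq_mul] at hprod
    rcases hprod with h0 | h0
    · exact ne_ratCast_of_natDegree_minpoly hquad a (by push_cast; linarith)
    · exact hβ0.ne' h0
  lift a to ℕ using ha.le
  rcases lt_or_gt_of_ne hb with hb | hb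
  · obtain ⟨d, rfl⟩ : ∃ d : ℕ, b = -d := ⟨b.natAbs, by lia⟩
    push_cast at *
    refine ⟨a, d, by lia, by lia, Or.inr ⟨by linarith, ?_⟩⟩
    nlinarith
  · lift b to ℕ using hb.le
    push_cast at *
    refine ⟨a, b, by lia, by lia, Or.inl ⟨by linarith, ?_⟩⟩
    nlinarith

theorem IsPisotEquation.dimH_nonMatchingSet {k d : ℕ} (hβ : 1 < β) (h : IsPisotEquation β k d) :
    dimH (nonMatchingSet β) = ENNReal.ofReal (Real.log d / Real.log β) := by
  obtain ⟨b, hb, hb1, hbd, hk | hk⟩ := h.exists_conjugate hβ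
  · exact dimH_nonMatchingSet_of_coding hb hb1 h.2.1 hbd 0
      (coding_of_add_eq_int hb hb1 (by linarith) hbd (k := k) (by exact_mod_cast hk))
  · exact dimH_nonMatchingSet_of_coding hb hb1 h.2.1 hbd b
      (coding_of_sub_eq_int hb hb1 (by linarith) hbd (k := k) (by exact_mod_cast hk))

/-- Since `d = b * β < β`, the non-matching set has dimension less than `1`. -/
theorem IsPisotEquation.exists_hasMatching {k d : ℕ} (hβ : 1 < β) (h : IsPisotEquation β k d) :
    ∃ α ∈ Set.Icc (0 : ℝ) 1, HasMatching β α := by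
  by_contra! hno
  have hset : nonMatchingSet β = Set.Icc 0 1 := by
    ext α
    exact ⟨fun hα => hα.1, fun hα => ⟨hα, hno α hα⟩⟩
  have hdim := h.dimH_nonMatchingSet hβ
  rw [hset, Real.dimH_of_nonempty_interior (by
    rw [interior_Icc]
    exact Set.nonempty_Ioo.2 zero_lt_one)] at hdim
  obtain ⟨b, hb, hb1, hbd, -⟩ := h.exists_conjugate hβ
  have hd : (0 : ℝ) < d := by exact_mod_cast h.2.1
  have hlt : Real.log d / Real.log β < 1 := by
    rw [div_lt_one (Real.log_pos hβ)]
    exact Real.log_lt_log hd (by nlinarith)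
  have := (ENNReal.ofReal_lt_one).2 hlt
  rw [← hdim] at this
  simp at this

end Pisot

theorem theorem1 (β : ℝ) (hβ : 1 < β) (hquad : (minpoly ℚ β).natDegree = 2) :
    ((∃ α ∈ Set.Icc (0 : ℝ) 1, HasMatching β α) ↔ IsPisot β) ∧
    (IsPisot β ↔ ∃ k d : ℕ, IsPisotEquation β k d) ∧
    (∀ k d : ℕ, IsPisotEquation β k d →
      dimH (nonMatchingSet β) = ENNReal.ofReal (Real.log d / Real.log β)) := by
  have hii : IsPisot β ↔ ∃ k d : ℕ, IsPisotEquation β k d :=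
    ⟨fun h => h.exists_isPisotEquation hβ hquad, fun ⟨_, _, h⟩ => h.isPisot hβ hquad⟩
  refine ⟨⟨fun ⟨_, _, h⟩ => h.isPisot hβ hquad, fun h => ?_⟩, hii,
    fun _ _ h => h.dimH_nonMatchingSet hβ⟩
  obtain ⟨_, _, hkd⟩ := hii.1 h
  exact hkd.exists_hasMatching hβ
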